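/- Let $B:[0,1]\to(0,\infty)$ be a normalization function with $B(0)=B(1)=1$, let $0<\alpha<1$, $b>0$, and let $\lambda\in\mathbb{R}$ with $\lambda\neq 0$. For $u\in H^1(0,b)$ with weak derivative $u'$, let $$({}^{ABC}{}_0D^\alpha u)(t)=\frac{B(\alpha)}{1-\alpha}\int_0^t E_\alpha\!\left[-\frac{\alpha}{1-\alpha}(t-s)^\alpha\right]u'(s)\,ds,\qquad E_\alpha(x)=\sum_{k=0}^\infty\frac{x^k}{\Gamma(\alpha k+1)},$$ be its left Caputo fractional derivative of order $\alpha$ with Mittag-Leffler non-singular kernel. Then the equation $$({}^{ABC}{}_0D^\alpha u)(t)=\lambda u(t),\qquad 0<t<b,$$ has in the space $H^1(0,b)\cap C[0,b]$ of real-valued functions exactly one solution, the trivial solution $u=0$. -/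

import Mathlib

open MeasureTheory Set
open scoped ContDiff

/-- The (one-parameter) Mittag-Leffler function `E_α(x) = ∑_{k ≥ 0} x ^ k / Γ(α k + 1)`
of a real argument. -/
noncomputable def mittagLeffler (α x : ℝ) : ℝ :=
  ∑' k : ℕ, x ^ k / Real.Gamma (α * k + 1)

/-- `v` is a weak derivative of `u` on the open interval `(a, b)`: both are locally integrable
there and `∫ u φ' = - ∫ v φ` for every smooth `φ` with compact support in `(a, b)`. -/
def HasWeakDeriv (a b : ℝ) (u v : ℝ → ℝ) : Prop :=
  LocallyIntegrableOn u (Ioo a b) ∧ LocallyIntegrableOn v (Ioo a b) ∧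
    ∀ φ : ℝ → ℝ, ContDiff ℝ ∞ φ → HasCompactSupport φ → tsupport φ ⊆ Ioo a b →
      ∫ x in Ioo a b, u x * deriv φ x = -∫ x in Ioo a b, v x * φ x

/-- `u` belongs to the Sobolev space `H¹(a, b)`: it is in `L²(a, b)` and has a weak derivative
in `L²(a, b)`. -/
def MemH1 (a b : ℝ) (u : ℝ → ℝ) : Prop :=
  MemLp u 2 (volume.restrict (Ioo a b)) ∧
    ∃ v : ℝ → ℝ, MemLp v 2 (volume.restrict (Ioo a b)) ∧ HasWeakDeriv a b u v

open Classical in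
/-- A representative of the weak derivative of `u` on `(a, b)`, which is unique up to equality
almost everywhere (`0` if there is none). -/
noncomputable def weakDeriv (a b : ℝ) (u : ℝ → ℝ) : ℝ → ℝ :=
  if h : ∃ v, HasWeakDeriv a b u v then h.choose else 0

/-- The left Caputo fractional derivative with Mittag-Leffler non-singular kernel, of order `α`,
base point `a` and normalization function `B`, of a function `u` on `(a, b)`:
`B(α) / (1 - α) * ∫_a^t E_α(-(α / (1 - α)) (t - s) ^ α) u'(s) ds`,
where `u'` is the weak derivative of `u` on `(a, b)`. -/
noncomputable def abcDeriv (B : ℝ → ℝ) (α a b : ℝ) (u : ℝ → ℝ) (t : ℝ) : ℝ :=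
  B α / (1 - α) *
    ∫ s in a..t, mittagLeffler α (-(α / (1 - α)) * (t - s) ^ α) * weakDeriv a b u s

/-- Weak derivatives are unique up to equality almost everywhere. -/
theorem HasWeakDeriv.weakDeriv_ae_eq {a b : ℝ} {u v : ℝ → ℝ} (h : HasWeakDeriv a b u v) :
    ∀ᵐ x, x ∈ Ioo a b → weakDeriv a b u x = v x := by
  have hex : ∃ w, HasWeakDeriv a b u w := ⟨v, h⟩
  have hw : HasWeakDeriv a b u (weakDeriv a b u) := by
    rw [weakDeriv, dif_pos hex]; exact hex.choose_spec
  generalize weakDeriv a b u = w at hw ⊢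
  have key : ∀ᵐ x, x ∈ Ioo a b → (w - v) x = 0 := by
    refine isOpen_Ioo.ae_eq_zero_of_integral_contDiff_smul_eq_zero (hw.2.1.sub h.2.1) ?_
    intro g hg hc hs
    have e := (hw.2.2 g hg hc hs).symm.trans (h.2.2 g hg hc hs)
    have int : ∀ f : ℝ → ℝ, LocallyIntegrableOn f (Ioo a b) →
        Integrable (fun x => f x * g x) := by
      intro f hf
      have h1 : IntegrableOn f (tsupport g) := hf.integrableOn_compact_subset hs hc
      have h2 : IntegrableOn (fun x => f x * g x) (tsupport g) :=
        h1.mul_continuousOn hg.continuous.continuousOn hc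
      refine (integrableOn_iff_integrable_of_support_subset ?_).1 h2
      intro x hx
      exact subset_tsupport g (fun h0 => hx (by simp [h0]))
    have supp : ∀ f : ℝ → ℝ, ∫ x in Ioo a b, f x * g x = ∫ x, f x * g x := by
      intro f
      refine setIntegral_eq_integral_of_forall_compl_eq_zero ?_
      intro x hx
      have : g x = 0 := image_eq_zero_of_notMem_tsupport (fun h0 => hx (hs h0))
      simp [this]
    rw [supp, supp] at e
    have e' : ∫ x, g x • (w - v) x = ∫ x, (w x * g x - v x * g x) := by
      congr 1; ext x; simp [smul_eq_mul]; ring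
    rw [e', integral_sub (int w hw.2.1) (int v h.2.1)]
    linarith
  filter_upwards [key] with x hx hm
  have := hx hm
  simp only [Pi.sub_apply] at this
  linarith

/-- The fractional derivative may be computed with any weak derivative of `u`. -/
theorem abcDeriv_eq {B : ℝ → ℝ} {α a b t : ℝ} {u v : ℝ → ℝ} (h : HasWeakDeriv a b u v)
    (hat : a ≤ t) (htb : t ≤ b) :
    abcDeriv B α a b u t = B α / (1 - α) *
      ∫ s in a..t, mittagLeffler α (-(α / (1 - α)) * (t - s) ^ α) * v s := by
  unfold abcDeriv
  congr 1
  refine intervalIntegral.integral_congr_ae ?_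
  have hb : ∀ᵐ x : ℝ, x ≠ b := by simp [ae_iff]
  filter_upwards [h.weakDeriv_ae_eq, hb] with x hx hxb hm
  rw [uIoc_of_le hat] at hm
  rw [hx ⟨hm.1, lt_of_le_of_ne (hm.2.trans htb) hxb⟩]

/-! Write g_a(t) = t^(a-1)/Γ(a), c = α/(1-α), K = B(α)/(1-α), k(t) = E_α(-c t^α), and * for causal
convolution; the equation reads K (k * u') = λu. As k is bounded on [0, b] and u' is integrable, the
left side tends to 0 at t = 0, so λ ≠ 0 forces u(0) = 0, whence u = 1 * u'. Integrating the series
of E_α termwise against g_α gives k + c (g_α * k) = 1 (`mittagLeffler_volterra`). Convolving the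
equation with g_α therefore leaves the Abel equation (K - λ) u = cλ (g_α * u).

If K ≠ λ, a sup norm with weight exp(-σt), σ large, makes the right side, divided by K - λ, a
contraction, so u = 0. If K = λ, then g_α * u = 0; convolving with g_(1-α) gives 1 * u = 0, and
differentiation gives u = 0. Associativity of * is only available almost everywhere; continuity of u
removes the exceptional sets. -/

/-! ### Riemann–Liouville kernels and causal convolution. -/

/-- The Riemann–Liouville kernel `t ^ (a - 1) / Γ(a)`. -/
noncomputable def fracKernel (a t : ℝ) : ℝ := t ^ (a - 1) / Real.Gamma a

/-- The causal convolution `∫_0^t f(t - s) g(s) ds`. -/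
noncomputable def causalConv (f g : ℝ → ℝ) (t : ℝ) : ℝ := ∫ s in (0 : ℝ)..t, f (t - s) * g s

theorem causalConv_congr {f f' g g' : ℝ → ℝ} {t : ℝ} (ht : 0 ≤ t)
    (hf : ∀ s ∈ Ioo 0 t, f s = f' s) (hg : ∀ s ∈ Ioo 0 t, g s = g' s) :
    causalConv f g t = causalConv f' g' t := by
  unfold causalConv
  rw [intervalIntegral.integral_of_le ht, intervalIntegral.integral_of_le ht,
    integral_Ioc_eq_integral_Ioo, integral_Ioc_eq_integral_Ioo]
  refine setIntegral_congr_fun measurableSet_Ioo fun s hs => ?_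
  rw [hg s hs, hf (t - s) ⟨by linarith [hs.2], by linarith [hs.1]⟩]

theorem causalConv_const_mul_right (c : ℝ) (f g : ℝ → ℝ) (t : ℝ) :
    causalConv f (fun s => c * g s) t = c * causalConv f g t := by
  unfold causalConv
  rw [← intervalIntegral.integral_const_mul]
  congr 1; ext s; ring

theorem fracKernel_nonneg {a t : ℝ} (ha : 0 < a) (ht : 0 ≤ t) : 0 ≤ fracKernel a t :=
  div_nonneg (Real.rpow_nonneg ht _) (Real.Gamma_pos_of_pos ha).le

theorem fracKernel_pos {a t : ℝ} (ha : 0 < a) (ht : 0 < t) : 0 < fracKernel a t :=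
  div_pos (Real.rpow_pos_of_pos ht _) (Real.Gamma_pos_of_pos ha)

theorem fracKernel_one (t : ℝ) : fracKernel 1 t = 1 := by simp [fracKernel]

theorem intervalIntegrable_fracKernel {a : ℝ} (ha : 0 < a) (x y : ℝ) :
    IntervalIntegrable (fracKernel a) volume x y :=
  (intervalIntegral.intervalIntegrable_rpow' (by linarith)).div_const _

/-- The semigroup property of the Riemann–Liouville kernels. -/
theorem causalConv_fracKernel {a b t : ℝ} (ha : 0 < a) (hb : 0 < b) (ht : 0 < t) :
    causalConv (fracKernel a) (fracKernel b) t = fracKernel (a + b) t := by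
  have h := Complex.betaIntegral_scaled (b : ℂ) (a : ℂ) ht
  have h2 := Complex.Gamma_mul_Gamma_eq_betaIntegral (s := (b : ℂ)) (t := (a : ℂ))
    (by simpa using hb) (by simpa using ha)
  have h3 : ∫ x in (0 : ℝ)..t, (x : ℂ) ^ ((b : ℂ) - 1) * ((t : ℂ) - x) ^ ((a : ℂ) - 1) =
      ((∫ x in (0 : ℝ)..t, x ^ (b - 1) * (t - x) ^ (a - 1) : ℝ) : ℂ) := by
    rw [← intervalIntegral.integral_ofReal]
    refine intervalIntegral.integral_congr fun x hx => ?_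
    rw [uIcc_of_le ht.le] at hx
    push_cast
    rw [Complex.ofReal_cpow hx.1, Complex.ofReal_cpow (sub_nonneg.2 hx.2)]
    push_cast
    rfl
  have hG := (Real.Gamma_pos_of_pos (add_pos hb ha)).ne'
  have h4 : (∫ x in (0 : ℝ)..t, x ^ (b - 1) * (t - x) ^ (a - 1)) * Real.Gamma (b + a) =
      t ^ (b + a - 1) * (Real.Gamma b * Real.Gamma a) := by
    have : ((t ^ (b + a - 1) : ℝ) : ℂ) = (t : ℂ) ^ ((b : ℂ) + a - 1) := by
      rw [Complex.ofReal_cpow ht.le]; push_cast; rfl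
    apply Complex.ofReal_injective
    push_cast
    rw [this, ← Complex.Gamma_ofReal, ← Complex.Gamma_ofReal, ← Complex.Gamma_ofReal, h2,
      ← h3, h]
    push_cast
    ring
  have h5 : causalConv (fracKernel a) (fracKernel b) t =
      (∫ x in (0 : ℝ)..t, x ^ (b - 1) * (t - x) ^ (a - 1)) /
        (Real.Gamma b * Real.Gamma a) := by
    unfold causalConv fracKernel
    rw [← intervalIntegral.integral_div]
    congr 1; ext s; field_simp
  have ha' := (Real.Gamma_pos_of_pos ha).ne'
  have hb' := (Real.Gamma_pos_of_pos hb).ne'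
  rw [h5, fracKernel, add_comm a b, div_eq_div_iff (mul_ne_zero hb' ha') hG, h4]

/-- A non-integrable function has integral 0 by convention, whereas the Beta integral gives a
positive value. -/
theorem intervalIntegrable_fracKernel_mul {a b t : ℝ} (ha : 0 < a) (hb : 0 < b) (ht : 0 < t) :
    IntervalIntegrable (fun s => fracKernel a (t - s) * fracKernel b s) volume 0 t := by
  by_contra h
  have h1 := causalConv_fracKernel ha hb ht
  rw [causalConv, intervalIntegral.integral_undef h] at h1
  exact (fracKernel_pos (add_pos ha hb) ht).ne h1

/-! ### The Mittag-Leffler function and its Volterra equation. -/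

/-- Restrict the Gamma integral to x > R, where x^s ≥ R^s. With R free, this shows that Γ(αn + 1)
outgrows every geometric sequence. -/
theorem rpow_le_exp_mul_Gamma {R s : ℝ} (hR : 0 < R) (hs : 0 ≤ s) :
    R ^ s ≤ Real.exp R * Real.Gamma (s + 1) := by
  have hint := Real.GammaIntegral_convergent (s := s + 1) (by linarith)
  have h1 : ∫ x in Ioi R, Real.exp (-x) * R ^ s ≤ Real.Gamma (s + 1) := by
    rw [Real.Gamma_eq_integral (by linarith)]
    refine (setIntegral_mono_on ?_ (hint.mono_set (Ioi_subset_Ioi hR.le)) measurableSet_Ioi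
      ?_).trans (setIntegral_mono_set hint ?_ (Ioi_subset_Ioi hR.le).eventuallyLE)
    · exact (integrableOn_exp_neg_Ioi R).mul_const _
    · intro x hx
      have : R ≤ x := le_of_lt hx
      rw [add_sub_cancel_right]
      gcongr
    · filter_upwards [self_mem_ae_restrict measurableSet_Ioi] with x hx
      have : 0 < x := hx
      simp only [Pi.zero_apply]
      positivity
  rw [integral_mul_const, integral_exp_neg_Ioi] at h1
  calc R ^ s = Real.exp R * (Real.exp (-R) * R ^ s) := by
        rw [← mul_assoc, ← Real.exp_add]; simp
    _ ≤ _ := by gcongr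

theorem exists_mittagLeffler_term_bound {α : ℝ} (hα : 0 < α) (M : ℝ) :
    ∃ w : ℕ → ℝ, Summable w ∧
      ∀ (n : ℕ) (x : ℝ), |x| ≤ M → |x ^ n / Real.Gamma (α * n + 1)| ≤ w n := by
  -- With R^α = Q, the Gamma bound at s = αn reads Q^n ≤ e^R Γ(αn + 1), and |x| ≤ Q/2 leaves the
  -- ratio 1/2.
  set Q := 2 * (|M| + 1) with hQ
  have hQ0 : 0 < Q := by positivity
  set R := Q ^ (1 / α)
  have hR : 0 < R := Real.rpow_pos_of_pos hQ0 _
  have hRQ : R ^ α = Q := by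
    rw [← Real.rpow_mul hQ0.le, one_div_mul_cancel hα.ne', Real.rpow_one]
  refine ⟨fun n => Real.exp R * (1 / 2) ^ n,
    (summable_geometric_of_lt_one (by norm_num) (by norm_num)).mul_left _, fun n x hx => ?_⟩
  have h0 : 0 ≤ α * n := by positivity
  have hG : 0 < Real.Gamma (α * n + 1) := Real.Gamma_pos_of_pos (by linarith)
  have h1 := rpow_le_exp_mul_Gamma hR h0
  rw [Real.rpow_mul hR.le, hRQ, Real.rpow_natCast] at h1
  rw [abs_div, abs_of_pos hG, div_le_iff₀ hG, abs_pow]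
  have h2 : |x| ≤ (1 / 2) * Q := by
    rw [hQ]; linarith [le_abs_self M]
  calc |x| ^ n ≤ ((1 / 2) * Q) ^ n := by gcongr
    _ = (1 / 2) ^ n * Q ^ n := mul_pow _ _ _
    _ ≤ (1 / 2) ^ n * (Real.exp R * Real.Gamma (α * n + 1)) := by gcongr
    _ = _ := by ring

theorem summable_mittagLeffler {α : ℝ} (hα : 0 < α) (x : ℝ) :
    Summable fun n : ℕ => x ^ n / Real.Gamma (α * n + 1) := by
  obtain ⟨w, hw, h⟩ := exists_mittagLeffler_term_bound hα |x|
  exact hw.of_norm_bounded fun n => h n x le_rfl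

theorem continuous_mittagLeffler {α : ℝ} (hα : 0 < α) : Continuous (mittagLeffler α) := by
  rw [continuous_iff_continuousAt]
  intro x
  obtain ⟨w, hw, h⟩ := exists_mittagLeffler_term_bound hα (|x| + 1)
  have hc : ContinuousOn (mittagLeffler α) {y | |y| ≤ |x| + 1} :=
    continuousOn_tsum (fun n => by fun_prop) hw fun n y hy => h n y hy
  refine hc.continuousAt ?_
  filter_upwards [continuous_abs.continuousAt.eventually_lt_const
    (show |x| < |x| + 1 by linarith)] with y hy using hy.le

theorem continuous_mittagLeffler_rpow {α : ℝ} (hα : 0 < α) (c : ℝ) :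
    Continuous fun t : ℝ => mittagLeffler α (-c * t ^ α) :=
  (continuous_mittagLeffler hα).comp
    (continuous_const.mul (Real.continuous_rpow_const hα.le))

theorem mittagLeffler_term_eq {α c t : ℝ} (ht : 0 ≤ t) (n : ℕ) :
    (-c * t ^ α) ^ n / Real.Gamma (α * n + 1) = (-c) ^ n * fracKernel (α * n + 1) t := by
  rw [mul_pow, fracKernel, add_sub_cancel_right, Real.rpow_mul ht, Real.rpow_natCast, mul_div_assoc]

/-- The Volterra equation satisfied by `t ↦ E_α(-c t ^ α)`. -/
theorem mittagLeffler_volterra {α c t : ℝ} (hα : 0 < α) (ht : 0 < t) :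
    mittagLeffler α (-c * t ^ α) +
      c * causalConv (fracKernel α) (fun s => mittagLeffler α (-c * s ^ α)) t = 1 := by
  have hpos : ∀ n : ℕ, 0 < α * n + 1 := fun n => by positivity
  have hnat : ∀ n : ℕ, α + (α * n + 1) = α * (n + 1 : ℕ) + 1 := fun n => by push_cast; ring
  have hsum : ∀ d : ℝ, Summable fun n : ℕ => (-d) ^ n * fracKernel (α * n + 1) t := fun d => by
    simpa only [mittagLeffler_term_eq ht.le] using summable_mittagLeffler hα (-d * t ^ α)
  have hsum' : ∀ d : ℝ, Summable fun n : ℕ => (-d) ^ n * fracKernel (α + (α * n + 1)) t := by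
    intro d
    -- This is the previous series shifted by one index and divided by -d; for d = 0 only the term n
    -- = 0 survives.
    rcases eq_or_ne d 0 with rfl | hd
    · refine summable_of_ne_finset_zero (s := {0}) fun n hn => ?_
      simp only [Finset.mem_singleton] at hn
      simp [hn]
    · refine (((summable_nat_add_iff 1).2 (hsum d)).mul_left (-d)⁻¹).congr fun n => ?_
      rw [hnat, pow_succ]
      field_simp
  set F : ℕ → ℝ → ℝ := fun n s =>
    fracKernel α (t - s) * ((-c) ^ n * fracKernel (α * n + 1) s) with hF
  have hFeq : ∀ n s, F n s = (-c) ^ n * (fracKernel α (t - s) * fracKernel (α * n + 1) s) :=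
    fun n s => by simp only [hF]; ring
  have hFint : ∀ n, Integrable (F n) (volume.restrict (Ioc 0 t)) := fun n => by
    have := ((intervalIntegrable_fracKernel_mul hα (hpos n) ht).const_mul ((-c) ^ n)).1
    simp only [← hFeq] at this
    exact this
  have hval : ∀ n, ∫ s in Ioc 0 t, F n s = (-c) ^ n * fracKernel (α + (α * n + 1)) t := fun n => by
    simp only [hFeq]
    rw [integral_const_mul, ← intervalIntegral.integral_of_le ht.le,
      ← causalConv_fracKernel hα (hpos n) ht]
    rfl
  -- The double sign puts |c|^n in the form of `hsum'` at d = -|c|, so the L¹ norms are summable.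
  have hnorm : ∀ n, ∫ s in Ioc 0 t, ‖F n s‖ = (-(-|c|)) ^ n * fracKernel (α + (α * n + 1)) t := by
    intro n
    rw [← causalConv_fracKernel hα (hpos n) ht, causalConv,
      intervalIntegral.integral_of_le ht.le, ← integral_const_mul]
    refine setIntegral_congr_fun measurableSet_Ioc fun s hs => ?_
    simp only [hFeq, norm_mul, norm_pow, norm_neg, Real.norm_eq_abs, neg_neg]
    rw [abs_of_nonneg (fracKernel_nonneg hα (sub_nonneg.2 hs.2)),
      abs_of_nonneg (fracKernel_nonneg (hpos n) hs.1.le)]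
  have hS := hasSum_integral_of_summable_integral_norm hFint
    (by simpa only [hnorm] using hsum' (-|c|))
  have hconv : causalConv (fracKernel α) (fun s => mittagLeffler α (-c * s ^ α)) t =
      ∫ s in Ioc 0 t, ∑' n, F n s := by
    rw [causalConv, intervalIntegral.integral_of_le ht.le]
    refine setIntegral_congr_fun measurableSet_Ioc fun s hs => ?_
    simp only [hF, mittagLeffler, mittagLeffler_term_eq hs.1.le, tsum_mul_left]
  rw [hconv, ← hS.tsum_eq, ← tsum_mul_left, mittagLeffler]
  simp only [mittagLeffler_term_eq ht.le, hval]
  -- The term n = 0 is 1; all later ones cancel against the convolved series.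
  rw [(hsum c).tsum_eq_zero_add]
  have : ∀ n : ℕ, c * ((-c) ^ n * fracKernel (α + (α * n + 1)) t) =
      -((-c) ^ (n + 1) * fracKernel (α * (n + 1 : ℕ) + 1) t) := fun n => by
    rw [hnat, pow_succ]; ring
  simp only [this, tsum_neg]
  simp [fracKernel_one]

/-! ### Associativity, by comparison with convolution on the line. -/

open scoped Convolution in
theorem convolution_eq_causalConv {F G f g : ℝ → ℝ} {b t : ℝ} (ht : t ∈ Ioo 0 b)
    (hF : ∀ s ≤ 0, F s = 0) (hG : ∀ s ≤ 0, G s = 0)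
    (hFf : ∀ s ∈ Ioo 0 b, F s = f s) (hGg : ∀ s ∈ Ioo 0 b, G s = g s) :
    (F ⋆[ContinuousLinearMap.mul ℝ ℝ, volume] G) t = causalConv g f t := by
  rw [convolution, causalConv, intervalIntegral.integral_of_le ht.1.le,
    integral_Ioc_eq_integral_Ioo,
    ← setIntegral_eq_integral_of_forall_compl_eq_zero (s := Ioo 0 t)]
  · refine setIntegral_congr_fun measurableSet_Ioo fun s hs => ?_
    have h1 : s < b := hs.2.trans ht.2
    simp only [ContinuousLinearMap.mul_apply']
    rw [hFf s ⟨hs.1, h1⟩, hGg (t - s) ⟨by linarith [hs.2], by linarith [hs.1, ht.2]⟩, mul_comm]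
  · intro s hs
    rcases le_or_gt s 0 with h | h
    · simp [hF s h]
    · have : t - s ≤ 0 := by
        by_contra h'
        exact hs ⟨h, by linarith⟩
      simp [hG _ this]

open scoped Convolution in
theorem convolution_eq_zero_of_nonpos {F G : ℝ → ℝ}
    (hF : ∀ s ≤ 0, F s = 0) (hG : ∀ s ≤ 0, G s = 0) {t : ℝ} (ht : t ≤ 0) :
    (F ⋆[ContinuousLinearMap.mul ℝ ℝ, volume] G) t = 0 := by
  rw [convolution]
  refine integral_eq_zero_of_ae (Filter.Eventually.of_forall fun s => ?_)
  rcases le_or_gt s 0 with h | h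
  · simp [hF s h]
  · simp [hG (t - s) (by linarith)]

open scoped Convolution in
/-- Causal convolution is associative almost everywhere. -/
theorem causalConv_assoc {f g h : ℝ → ℝ} {b : ℝ} (hf : IntegrableOn f (Ioo 0 b))
    (hg : IntegrableOn g (Ioo 0 b)) (hh : IntegrableOn h (Ioo 0 b)) :
    ∀ᵐ t, t ∈ Ioo 0 b →
      causalConv f (causalConv g h) t = causalConv (causalConv f g) h t := by
  set F := (Ioo 0 b).indicator f
  set G := (Ioo 0 b).indicator g
  set H := (Ioo 0 b).indicator h
  have hF : Integrable F := hf.integrable_indicator measurableSet_Ioo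
  have hG : Integrable G := hg.integrable_indicator measurableSet_Ioo
  have hH : Integrable H := hh.integrable_indicator measurableSet_Ioo
  have zero : ∀ k : ℝ → ℝ, ∀ s ≤ 0, (Ioo 0 b).indicator k s = 0 := fun k s hs =>
    indicator_of_notMem (fun h => (hs.trans_lt h.1).false) _
  have val : ∀ k : ℝ → ℝ, ∀ s ∈ Ioo 0 b, (Ioo 0 b).indicator k s = k s := fun k s hs =>
    indicator_of_mem hs _
  have hGn := hG.norm
  have hFn := hF.norm
  -- The exceptional t are those where the triple convolution of absolute values may diverge, so
  -- that Fubini is unavailable.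
  filter_upwards [hH.norm.ae_convolution_exists (ContinuousLinearMap.mul ℝ ℝ)
    (hGn.integrable_convolution (ContinuousLinearMap.mul ℝ ℝ) hFn)] with t hex ht
  have key := convolution_assoc (ContinuousLinearMap.mul ℝ ℝ) (ContinuousLinearMap.mul ℝ ℝ)
    (ContinuousLinearMap.mul ℝ ℝ) (ContinuousLinearMap.mul ℝ ℝ)
    (fun x y z => by simp [mul_assoc]) (x₀ := t) hH.aestronglyMeasurable
    hG.aestronglyMeasurable hF.aestronglyMeasurable
    (hH.ae_convolution_exists (ContinuousLinearMap.mul ℝ ℝ) hG)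
    (hGn.ae_convolution_exists (ContinuousLinearMap.mul ℝ ℝ) hFn) hex
  rwa [convolution_eq_causalConv ht
      (fun s hs => convolution_eq_zero_of_nonpos (zero h) (zero g) hs) (zero f)
      (fun s hs => convolution_eq_causalConv hs (zero h) (zero g) (val h) (val g)) (val f),
    convolution_eq_causalConv ht (zero h)
      (fun s hs => convolution_eq_zero_of_nonpos (zero g) (zero f) hs) (val h)
      (fun s hs => convolution_eq_causalConv hs (zero g) (zero f) (val g) (val f))] at key

/-! ### Weak derivatives and primitives. -/

theorem exists_smooth_compactSupport_integral_eq_one {a b : ℝ} (hab : a < b) :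
    ∃ ψ : ℝ → ℝ, ContDiff ℝ ∞ ψ ∧ HasCompactSupport ψ ∧ tsupport ψ ⊆ Ioo a b ∧
      ∫ x, ψ x = 1 := by
  let f : ContDiffBump ((a + b) / 2) :=
    ⟨(b - a) / 8, (b - a) / 4, by linarith, by linarith⟩
  refine ⟨f.normed volume, f.contDiff_normed, f.hasCompactSupport_normed, ?_,
    f.integral_normed⟩
  rw [f.tsupport_normed_eq, Real.closedBall_eq_Icc]
  intro x hx
  have h1 : (a + b) / 2 - (b - a) / 4 ≤ x := hx.1
  have h2 : x ≤ (a + b) / 2 + (b - a) / 4 := hx.2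
  constructor <;> linarith

/-- A test function of integral zero is the derivative of a test function. -/
theorem exists_primitive_of_integral_eq_zero {a b : ℝ} {g : ℝ → ℝ} (hab : a < b)
    (hg : ContDiff ℝ ∞ g) (hs : tsupport g ⊆ Ioo a b) (hc : HasCompactSupport g)
    (h0 : ∫ x, g x = 0) :
    ∃ φ : ℝ → ℝ, ContDiff ℝ ∞ φ ∧ HasCompactSupport φ ∧ tsupport φ ⊆ Ioo a b ∧
      deriv φ = g := by
  have hd : ∀ x, HasDerivAt (fun x => ∫ s in a..x, g s) (g x) x := fun x =>
    intervalIntegral.integral_hasDerivAt_right (hg.continuous.intervalIntegrable _ _)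
      (hg.continuous.stronglyMeasurableAtFilter _ _) hg.continuous.continuousAt
  have hderiv : deriv (fun x => ∫ s in a..x, g s) = g := funext fun x => (hd x).deriv
  obtain ⟨c, d, hcd, hsub⟩ : ∃ c d, Icc c d ⊆ Ioo a b ∧ tsupport g ⊆ Icc c d := by
    rcases (tsupport g).eq_empty_or_nonempty with he | hne
    · exact ⟨(a + b) / 2, (a + b) / 2, fun x hx => by
        rw [Icc_self, mem_singleton_iff] at hx
        subst hx; constructor <;> linarith, by simp [he]⟩
    · obtain ⟨c, hc1, hc2⟩ := hc.isCompact.exists_isLeast hne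
      obtain ⟨d, hd1, hd2⟩ := hc.isCompact.exists_isGreatest hne
      exact ⟨c, d, fun x hx => ⟨(hs hc1).1.trans_le hx.1, hx.2.trans_lt (hs hd1).2⟩,
        fun x hx => ⟨hc2 hx, hd2 hx⟩⟩
  have hgz : ∀ x ∉ Icc c d, g x = 0 := fun x hx =>
    image_eq_zero_of_notMem_tsupport fun h => hx (hsub h)
  have hsupp : Function.support (fun x => ∫ s in a..x, g s) ⊆ Icc c d := by
    intro x hx
    by_contra hxn
    refine hx ?_
    rcases lt_or_ge x c with h | h
    · rcases le_or_gt c d with hcd' | hcd'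
      · have hac : a < c := (hcd (left_mem_Icc.2 hcd')).1
        refine intervalIntegral.integral_zero_ae (Filter.Eventually.of_forall fun s hs' => ?_)
        refine hgz s fun hs'' => ?_
        have := uIoc_subset_uIcc hs'
        have : s ≤ max a x := by
          rw [uIcc, mem_Icc] at this; exact this.2
        have : max a x < c := max_lt hac h
        linarith [hs''.1]
      · have : ∀ s, g s = 0 := fun s => hgz s (by rw [Icc_eq_empty hcd'.not_ge]; simp)
        simp [this]
    · have hdx : d < x := by
        by_contra h'
        exact hxn ⟨h, not_lt.1 h'⟩
      -- To the right of the support the primitive equals the full integral of g, which is zero.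
      by_cases hax : a ≤ x
      · beta_reduce
        rw [← h0, intervalIntegral.integral_of_le hax]
        refine setIntegral_eq_integral_of_forall_compl_eq_zero fun s hs' => hgz s fun hs'' => ?_
        exact hs' ⟨(hcd hs'').1, hs''.2.trans hdx.le⟩
      · have : ∀ s, g s = 0 := fun s => hgz s fun h' => by
          linarith [(hcd h').1, h'.2]
        simp [this]
  refine ⟨fun x => ∫ s in a..x, g s, ?_, ?_, ?_, hderiv⟩
  · rw [contDiff_infty_iff_deriv, hderiv]
    exact ⟨fun x => (hd x).differentiableAt, hg⟩
  · exact HasCompactSupport.intro isCompact_Icc fun x hx => by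
      by_contra h; exact hx (hsupp h)
  · exact (closure_minimal hsupp isClosed_Icc).trans hcd

/-- The du Bois-Reymond lemma. -/
theorem ae_const_of_integral_mul_deriv_eq_zero {a b : ℝ} {w : ℝ → ℝ} (hab : a < b)
    (hw : LocallyIntegrableOn w (Ioo a b))
    (h : ∀ φ : ℝ → ℝ, ContDiff ℝ ∞ φ → HasCompactSupport φ → tsupport φ ⊆ Ioo a b →
      ∫ x in Ioo a b, w x * deriv φ x = 0) :
    ∃ C, ∀ᵐ x, x ∈ Ioo a b → w x = C := by
  obtain ⟨ψ, hψ, hψc, hψs, hψ1⟩ := exists_smooth_compactSupport_integral_eq_one hab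
  set C := ∫ x in Ioo a b, w x * ψ x with hC
  refine ⟨C, ?_⟩
  have hwC : LocallyIntegrableOn (fun x => w x - C) (Ioo a b) :=
    hw.sub ((locallyIntegrable_const C).locallyIntegrableOn _)
  have int : ∀ f g : ℝ → ℝ, LocallyIntegrableOn f (Ioo a b) → Continuous g →
      HasCompactSupport g → tsupport g ⊆ Ioo a b → Integrable (fun x => f x * g x) := by
    intro f g hf hg hc hs
    have h1 : IntegrableOn f (tsupport g) := hf.integrableOn_compact_subset hs hc
    refine (integrableOn_iff_integrable_of_support_subset ?_).1
      (h1.mul_continuousOn hg.continuousOn hc)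
    intro x hx
    exact subset_tsupport g (fun h0 => hx (by simp [h0]))
  have supp : ∀ f g : ℝ → ℝ, tsupport g ⊆ Ioo a b →
      ∫ x in Ioo a b, f x * g x = ∫ x, f x * g x := by
    intro f g hs
    refine setIntegral_eq_integral_of_forall_compl_eq_zero fun x hx => ?_
    simp [image_eq_zero_of_notMem_tsupport (fun h0 => hx (hs h0))]
  have key : ∀ᵐ x, x ∈ Ioo a b → w x - C = 0 := by
    refine isOpen_Ioo.ae_eq_zero_of_integral_contDiff_smul_eq_zero hwC fun g hg hgc hgs => ?_
    -- Subtracting Iψ makes the integral of g zero, so g - Iψ is an admissible φ'; the hypothesis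
    -- then gives ∫ w g = I C.
    set I := ∫ x, g x with hI
    have hgi : Integrable g := hg.continuous.integrable_of_hasCompactSupport hgc
    have hψi : Integrable ψ := hψ.continuous.integrable_of_hasCompactSupport hψc
    have hts : tsupport (fun x => g x - I * ψ x) ⊆ tsupport g ∪ tsupport ψ := by
      refine closure_minimal (fun x hx => ?_)
        ((isClosed_tsupport g).union (isClosed_tsupport ψ))
      by_contra hn
      rw [mem_union, not_or] at hn
      refine hx ?_
      simp [image_eq_zero_of_notMem_tsupport hn.1, image_eq_zero_of_notMem_tsupport hn.2]
    obtain ⟨φ, hφ, hφc, hφs, hφd⟩ := exists_primitive_of_integral_eq_zero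
      (g := fun x => g x - I * ψ x) hab (hg.sub (contDiff_const.mul hψ))
      (hts.trans (union_subset hgs hψs))
      (HasCompactSupport.of_support_subset_isCompact (hgc.isCompact.union hψc.isCompact)
        ((subset_tsupport _).trans hts))
      (by rw [integral_sub hgi (hψi.const_mul I), integral_const_mul, hψ1, ← hI]; ring)
    have e := h φ hφ hφc hφs
    rw [hφd] at e
    have i1 := int w g hw hg.continuous hgc hgs
    have i2 := int w ψ hw hψ.continuous hψc hψs
    have e1 : ∫ x in Ioo a b, w x * (g x - I * ψ x) = (∫ x, w x * g x) - I * C := by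
      rw [hC, supp w ψ hψs, ← supp w g hgs, ← supp w ψ hψs, ← integral_const_mul,
        ← integral_sub i1.integrableOn (i2.integrableOn.const_mul I)]
      congr 1; ext x; ring
    have e2 : ∫ x, g x • (w x - C) = (∫ x, w x * g x) - C * I := by
      rw [hI, ← integral_const_mul, ← integral_sub i1 (hgi.const_mul C)]
      congr 1; ext x; simp only [smul_eq_mul]; ring
    rw [e2]
    linarith
  filter_upwards [key] with x hx hm
  linarith [hx hm]

/-- Integration by parts for absolutely continuous functions; the boundary terms vanish with φ. -/
theorem integral_primitive_mul_deriv {a b : ℝ} {v φ : ℝ → ℝ} (hab : a ≤ b)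
    (hv : IntegrableOn v (Ioo a b)) (hφ : ContDiff ℝ ∞ φ) (hs : tsupport φ ⊆ Ioo a b) :
    ∫ x in Ioo a b, (∫ s in a..x, v s) * deriv φ x = -∫ x in Ioo a b, v x * φ x := by
  have hvi : IntervalIntegrable v volume a b :=
    (intervalIntegrable_iff_integrableOn_Ioo_of_le hab).2 hv
  have hφa : φ a = 0 := image_eq_zero_of_notMem_tsupport fun h => (hs h).1.false
  have hφb : φ b = 0 := image_eq_zero_of_notMem_tsupport fun h => (hs h).2.false
  have hd : Continuous (deriv φ) := hφ.continuous_deriv (by simp)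
  have hφac : AbsolutelyContinuousOnInterval φ a b := by
    have : φ = fun x => ∫ s in a..x, deriv φ s := funext fun x => by
      rw [intervalIntegral.integral_deriv_eq_sub
        (fun y _ => hφ.differentiable (by simp) y) (hd.intervalIntegrable _ _), hφa, sub_zero]
    rw [this]
    exact (hd.intervalIntegrable a b).absolutelyContinuousOnInterval_intervalIntegral left_mem_uIcc
  have hVac := hvi.absolutelyContinuousOnInterval_intervalIntegral (c := a) left_mem_uIcc
  have e := hVac.integral_mul_deriv_eq_deriv_mul hφac
  simp only [hφa, hφb, mul_zero, sub_zero, zero_sub] at e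
  rw [← integral_Ioc_eq_integral_Ioo, ← integral_Ioc_eq_integral_Ioo,
    ← intervalIntegral.integral_of_le hab, ← intervalIntegral.integral_of_le hab, e]
  congr 1
  refine intervalIntegral.integral_congr_ae ?_
  filter_upwards [hvi.ae_hasDerivAt_integral] with x hx hm
  rw [(hx (uIoc_subset_uIcc hm) a left_mem_uIcc).deriv]

/-- A continuous function with integrable weak derivative is the primitive of that derivative. -/
theorem HasWeakDeriv.eq_add_integral {a b : ℝ} {u v : ℝ → ℝ} (hab : a < b)
    (h : HasWeakDeriv a b u v) (hu : ContinuousOn u (Icc a b)) (hv : IntegrableOn v (Ioo a b)) :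
    ∀ t ∈ Icc a b, u t = u a + ∫ s in a..t, v s := by
  have hvi : IntegrableOn v (Icc a b) := by
    rwa [integrableOn_Icc_iff_integrableOn_Ioo]
  have hV : ContinuousOn (fun x => ∫ s in a..x, v s) (Icc a b) := by
    rw [← uIcc_of_le hab.le] at hvi ⊢
    exact intervalIntegral.continuousOn_primitive_interval hvi
  have hw : ContinuousOn (fun x => u x - ∫ s in a..x, v s) (Icc a b) := hu.sub hV
  obtain ⟨C, hC⟩ := ae_const_of_integral_mul_deriv_eq_zero hab
    (w := fun x => u x - ∫ s in a..x, v s)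
    ((hw.integrableOn_Icc.mono_set Ioo_subset_Icc_self).locallyIntegrableOn) (by
      intro φ hφ hφc hφs
      have hd : ContinuousOn (deriv φ) (Icc a b) := (hφ.continuous_deriv (by simp)).continuousOn
      simp only [sub_mul]
      rw [integral_sub (f := fun x => u x * deriv φ x)
        (g := fun x => (∫ s in a..x, v s) * deriv φ x) ((hu.mul hd).integrableOn_Icc.mono_set Ioo_subset_Icc_self)
        ((hV.mul hd).integrableOn_Icc.mono_set Ioo_subset_Icc_self), h.2.2 φ hφ hφc hφs,
        integral_primitive_mul_deriv hab.le hv hφ hφs, sub_self])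
  have hEq : EqOn (fun x => u x - ∫ s in a..x, v s) (fun _ => C) (Icc a b) := by
    refine Measure.eqOn_Icc_of_ae_eq volume hab.ne ?_ hw continuousOn_const
    rw [← restrict_Ioo_eq_restrict_Icc]
    exact (ae_restrict_iff' measurableSet_Ioo).2 hC
  intro t ht
  have h1 := hEq ht
  have h2 := hEq (left_mem_Icc.2 hab.le)
  simp only [intervalIntegral.integral_same] at h1 h2
  linarith

/-! ### Uniqueness for Abel equations. -/

/-- After s ↦ t - s this is exp(σt) times a truncated Laplace transform of the kernel, whose full
value is σ^(-α). -/
theorem causalConv_fracKernel_exp_le {α σ t : ℝ} (hα : 0 < α) (hσ : 0 < σ) (ht : 0 ≤ t) :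
    causalConv (fracKernel α) (fun s => Real.exp (σ * s)) t ≤ Real.exp (σ * t) * (1 / σ) ^ α := by
  have hG := Real.Gamma_pos_of_pos hα
  have hI := Real.integral_rpow_mul_exp_neg_mul_Ioi hα hσ
  have hpos : 0 < (1 / σ) ^ α * Real.Gamma α := by positivity
  have hint : IntegrableOn (fun r : ℝ => r ^ (α - 1) * Real.exp (-(σ * r))) (Ioi 0) := by
    by_contra hn
    rw [integral_undef hn] at hI
    exact hpos.ne hI
  have h1 : causalConv (fracKernel α) (fun s => Real.exp (σ * s)) t =
      Real.exp (σ * t) / Real.Gamma α *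
        ∫ r in (0 : ℝ)..t, r ^ (α - 1) * Real.exp (-(σ * r)) := by
    have := intervalIntegral.integral_comp_sub_left (a := 0) (b := t)
      (fun r : ℝ => r ^ (α - 1) * Real.exp (-(σ * r))) t
    rw [sub_self, sub_zero] at this
    rw [← this, ← intervalIntegral.integral_const_mul, causalConv]
    congr 1; ext s
    have : Real.exp (σ * s) = Real.exp (σ * t) * Real.exp (-(σ * (t - s))) := by
      rw [← Real.exp_add]; congr 1; ring
    rw [this, fracKernel]
    ring
  have h2 : ∫ r in (0 : ℝ)..t, r ^ (α - 1) * Real.exp (-(σ * r)) ≤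
      (1 / σ) ^ α * Real.Gamma α := by
    rw [intervalIntegral.integral_of_le ht, ← hI]
    refine setIntegral_mono_set hint ?_ Ioc_subset_Ioi_self.eventuallyLE
    filter_upwards [self_mem_ae_restrict measurableSet_Ioi] with x hx
    have : 0 < x := hx
    simp only [Pi.zero_apply]
    positivity
  rw [h1]
  calc _ ≤ Real.exp (σ * t) / Real.Gamma α * ((1 / σ) ^ α * Real.Gamma α) := by gcongr
    _ = _ := by field_simp

/-- A homogeneous Abel equation of the second kind has only the trivial continuous solution. -/
theorem eq_zero_of_ae_eq_mul_causalConv_fracKernel {α b μ : ℝ} {u : ℝ → ℝ} (hα : 0 < α)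
    (hb : 0 < b) (hu : ContinuousOn u (Icc 0 b))
    (h : ∀ᵐ t, t ∈ Ioo 0 b → u t = μ * causalConv (fracKernel α) u t) :
    ∀ t ∈ Icc 0 b, u t = 0 := by
  -- Chosen so that σ^α = Q and the contraction constant |μ| σ^(-α) is at most 1/2.
  set Q := 2 * (|μ| + 1) with hQ
  have hQ0 : 0 < Q := by positivity
  set σ := Q ^ (1 / α) with hσdef
  have hσ : 0 < σ := Real.rpow_pos_of_pos hQ0 _
  have hσα : (1 / σ) ^ α = 1 / Q := by
    rw [Real.div_rpow zero_le_one hσ.le, Real.one_rpow, hσdef, ← Real.rpow_mul hQ0.le,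
      one_div_mul_cancel hα.ne', Real.rpow_one]
  have hμ : |μ| * (1 / Q) ≤ 1 / 2 := by
    rw [mul_one_div, div_le_iff₀ hQ0, hQ]; linarith
  set f : ℝ → ℝ := fun t => Real.exp (-(σ * t)) * |u t| with hf
  have hfc : ContinuousOn f (Icc 0 b) := by
    refine ContinuousOn.mul ?_ hu.abs
    fun_prop
  obtain ⟨t₀, ht₀, hmax⟩ := isCompact_Icc.exists_isMaxOn (nonempty_Icc.2 hb.le) hfc
  set M := f t₀ with hM
  have hM0 : 0 ≤ M := by rw [hM, hf]; positivity
  have hub : ∀ s ∈ Icc 0 b, |u s| ≤ M * Real.exp (σ * s) := by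
    intro s hs
    have h1 : f s ≤ M := hmax hs
    calc |u s| = f s * Real.exp (σ * s) := by
          rw [hf]; simp only
          rw [mul_right_comm, ← Real.exp_add]; simp
      _ ≤ _ := by gcongr
  have hae : ∀ᵐ t, t ∈ Ioo 0 b → f t ≤ M / 2 := by
    filter_upwards [h] with t ht hm
    have hint : IntervalIntegrable (fun s => fracKernel α (t - s) * (M * Real.exp (σ * s)))
        volume 0 t := by
      have h1 := (intervalIntegrable_fracKernel hα t 0).comp_sub_left t
      rw [sub_self, sub_zero] at h1
      exact h1.mul_continuousOn (by fun_prop)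
    have h2 : |causalConv (fracKernel α) u t| ≤
        causalConv (fracKernel α) (fun s => M * Real.exp (σ * s)) t := by
      rw [← Real.norm_eq_abs, causalConv, causalConv]
      refine intervalIntegral.norm_integral_le_of_norm_le hm.1.le
        (Filter.Eventually.of_forall fun s hs => ?_) hint
      have h3 := fracKernel_nonneg hα (sub_nonneg.2 hs.2)
      rw [norm_mul, Real.norm_eq_abs, Real.norm_eq_abs, abs_of_nonneg h3]
      exact mul_le_mul_of_nonneg_left (hub s ⟨hs.1.le, hs.2.trans hm.2.le⟩) h3
    rw [causalConv_const_mul_right] at h2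
    have h4 := causalConv_fracKernel_exp_le hα hσ hm.1.le
    rw [hσα] at h4
    have h5 : |u t| ≤ M / 2 * Real.exp (σ * t) := by
      rw [ht hm, abs_mul]
      calc |μ| * |causalConv (fracKernel α) u t|
          ≤ |μ| * (M * (Real.exp (σ * t) * (1 / Q))) := by
            gcongr
            exact h2.trans (by gcongr)
        _ = (|μ| * (1 / Q)) * (M * Real.exp (σ * t)) := by ring
        _ ≤ 1 / 2 * (M * Real.exp (σ * t)) := by gcongr
        _ = _ := by ring
    calc f t ≤ Real.exp (-(σ * t)) * (M / 2 * Real.exp (σ * t)) := by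
          rw [hf]; simp only; gcongr
      _ = M / 2 := by
          rw [mul_left_comm, ← Real.exp_add]; simp
  -- The positive part turns the a.e. inequality f ≤ M/2 into an a.e. equality of continuous
  -- functions, valid everywhere; at the maximum point it reads M ≤ M/2.
  have hEq : EqOn (fun t => max (f t - M / 2) 0) (fun _ => 0) (Icc 0 b) := by
    refine Measure.eqOn_Icc_of_ae_eq volume hb.ne ?_
      ((hfc.sub continuousOn_const).sup continuousOn_const) continuousOn_const
    rw [← restrict_Ioo_eq_restrict_Icc]
    refine (ae_restrict_iff' measurableSet_Ioo).2 ?_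
    filter_upwards [hae] with t ht hm
    exact max_eq_right (by linarith [ht hm])
  have h6 : M - M / 2 ≤ 0 := by
    have := hEq ht₀
    simp only at this
    exact (le_max_left _ _).trans_eq this
  intro t ht
  have h7 := hub t ht
  have h8 : M = 0 := by linarith
  rw [h8, zero_mul] at h7
  exact abs_nonpos_iff.1 h7

/-- The Riemann–Liouville integral of order less than one is injective on continuous functions. -/
theorem eq_zero_of_ae_causalConv_fracKernel_eq_zero {α b : ℝ} {u : ℝ → ℝ} (hα : 0 < α)
    (hα1 : α < 1) (hb : 0 < b) (hu : ContinuousOn u (Icc 0 b))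
    (h : ∀ᵐ t, t ∈ Ioo 0 b → causalConv (fracKernel α) u t = 0) :
    ∀ t ∈ Icc 0 b, u t = 0 := by
  have hk : ∀ a : ℝ, 0 < a → IntegrableOn (fracKernel a) (Ioo 0 b) := fun a ha =>
    (intervalIntegrable_iff_integrableOn_Ioo_of_le hb.le).1 (intervalIntegrable_fracKernel ha 0 b)
  have hui := hu.integrableOn_Icc.mono_set (μ := volume) Ioo_subset_Icc_self
  have hprim : ∀ᵐ t, t ∈ Ioo 0 b → ∫ s in (0 : ℝ)..t, u s = 0 := by
    -- The kernels of orders 1 - α and α convolve to the constant 1.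
    filter_upwards [causalConv_assoc (hk (1 - α) (by linarith)) (hk α hα) hui] with t ht hm
    have h1 := ht hm
    have h2 : causalConv (fracKernel (1 - α)) (causalConv (fracKernel α) u) t = 0 := by
      refine intervalIntegral.integral_zero_ae ?_
      filter_upwards [h] with s hs hst
      rw [uIoc_of_le hm.1.le] at hst
      rw [hs ⟨hst.1, hst.2.trans_lt hm.2⟩, mul_zero]
    have h3 : causalConv (causalConv (fracKernel (1 - α)) (fracKernel α)) u t =
        causalConv (fun _ => 1) u t :=
      causalConv_congr hm.1.le (fun s hs => by
        rw [causalConv_fracKernel (by linarith) hα hs.1, sub_add_cancel, fracKernel_one])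
        fun _ _ => rfl
    rw [h2, h3] at h1
    simpa [causalConv] using h1.symm
  have hP : EqOn (fun t => ∫ s in (0 : ℝ)..t, u s) (fun _ => 0) (Icc 0 b) := by
    refine Measure.eqOn_Icc_of_ae_eq volume hb.ne ?_ ?_ continuousOn_const
    · rw [← restrict_Ioo_eq_restrict_Icc]
      exact (ae_restrict_iff' measurableSet_Ioo).2 hprim
    · have := hu.integrableOn_Icc (μ := volume)
      rw [← uIcc_of_le hb.le] at this ⊢
      exact intervalIntegral.continuousOn_primitive_interval this
  refine Measure.eqOn_Icc_of_ae_eq volume hb.ne ?_ hu continuousOn_const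
  rw [← restrict_Ioo_eq_restrict_Icc]
  refine (ae_restrict_iff' measurableSet_Ioo).2 (Filter.Eventually.of_forall fun t ht => ?_)
  have hd : HasDerivAt (fun t => ∫ s in (0 : ℝ)..t, u s) (u t) t :=
    intervalIntegral.integral_hasDerivAt_right
      ((hu.mono (Icc_subset_Icc_right ht.2.le)).intervalIntegrable_of_Icc ht.1.le)
      (ContinuousOn.stronglyMeasurableAtFilter isOpen_Ioo (hu.mono Ioo_subset_Icc_self) t ht)
      (hu.continuousAt (Icc_mem_nhds ht.1 ht.2))
  have h0 : HasDerivAt (fun t => ∫ s in (0 : ℝ)..t, u s) 0 t :=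
    (hasDerivAt_const t (0 : ℝ)).congr_of_eventuallyEq
      (Filter.eventuallyEq_of_mem (Icc_mem_nhds ht.1 ht.2) hP)
  exact hd.unique h0

/-! ### Reduction to an Abel equation and conclusion. -/

/-- The convolution is dominated by C ∫_0^t |v|, with C a bound for k on [0, b]. This yields the
initial value u(0) = 0. -/
theorem tendsto_causalConv_nhdsGT_zero {k v : ℝ → ℝ} {b : ℝ} (hb : 0 < b) (hk : Continuous k)
    (hv : IntegrableOn v (Ioo 0 b)) :
    Filter.Tendsto (causalConv k v) (nhdsWithin 0 (Ioo 0 b)) (nhds 0) := by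
  obtain ⟨C, hC⟩ := isCompact_Icc.exists_bound_of_continuousOn (s := Icc 0 b) hk.continuousOn
  have hvi : IntegrableOn (fun s => C * ‖v s‖) (Icc 0 b) := by
    rw [integrableOn_Icc_iff_integrableOn_Ioo]
    exact hv.norm.const_mul C
  have hVc : ContinuousOn (fun t => ∫ s in (0 : ℝ)..t, C * ‖v s‖) (Icc 0 b) := by
    rw [← uIcc_of_le hb.le] at hvi ⊢
    exact intervalIntegral.continuousOn_primitive_interval hvi
  have h0 := (hVc 0 (left_mem_Icc.2 hb.le)).tendsto.mono_left
    (nhdsWithin_mono 0 Ioo_subset_Icc_self)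
  simp only [intervalIntegral.integral_same] at h0
  refine squeeze_zero_norm' ?_ h0
  filter_upwards [self_mem_nhdsWithin] with t ht
  refine intervalIntegral.norm_integral_le_of_norm_le ht.1.le
    (Filter.Eventually.of_forall fun s hs => ?_) ?_
  · rw [norm_mul]
    gcongr
    exact hC _ ⟨by linarith [hs.2], by linarith [hs.1, ht.2]⟩
  · exact (intervalIntegrable_iff_integrableOn_Icc_of_le ht.1.le).2
      (hvi.mono_set (Icc_subset_Icc_right ht.2.le))

/-- Convolving a relation `K (k * v) = lam u`, where `k` is the Mittag-Leffler kernel and `v` the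
derivative of `u`, with the Riemann–Liouville kernel yields an Abel equation for `u`. -/
theorem abel_equation_of_causalConv_mittagLeffler {α b c K lam : ℝ} {u v : ℝ → ℝ} (hα : 0 < α)
    (hb : 0 < b) (hc : c ≠ 0) (hK : K ≠ 0) (hv : IntegrableOn v (Ioo 0 b))
    (huv : ∀ t ∈ Ioo 0 b, u t = ∫ s in (0 : ℝ)..t, v s)
    (h : ∀ t ∈ Ioo 0 b,
      K * causalConv (fun s => mittagLeffler α (-c * s ^ α)) v t = lam * u t) :
    ∀ᵐ t, t ∈ Ioo 0 b → (K - lam) * u t = c * lam * causalConv (fracKernel α) u t := by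
  set k : ℝ → ℝ := fun s => mittagLeffler α (-c * s ^ α) with hk
  have hkc : Continuous k := continuous_mittagLeffler_rpow hα c
  have hg : IntegrableOn (fracKernel α) (Ioo 0 b) :=
    (intervalIntegrable_iff_integrableOn_Ioo_of_le hb.le).1 (intervalIntegrable_fracKernel hα 0 b)
  have hkv : ∀ t ∈ Ioo 0 b, causalConv k v t = lam / K * u t := fun t ht => by
    have := h t ht
    field_simp
    linarith
  filter_upwards [causalConv_assoc hg
    (hkc.continuousOn.integrableOn_Icc.mono_set Ioo_subset_Icc_self) hv] with t ht hm
  have h1 := ht hm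
  have h2 : causalConv (fracKernel α) (causalConv k v) t =
      causalConv (fracKernel α) (fun s => lam / K * u s) t :=
    causalConv_congr hm.1.le (fun _ _ => rfl) fun s hs => hkv s ⟨hs.1, hs.2.trans hm.2⟩
  -- The Volterra equation solved for the convolution of `fracKernel α` with k.
  have h3 : causalConv (causalConv (fracKernel α) k) v t =
      causalConv (fun s => c⁻¹ * (1 - k s)) v t :=
    causalConv_congr hm.1.le (fun s hs => by
      rw [← mittagLeffler_volterra (c := c) hα hs.1, hk]
      field_simp
      ring) fun _ _ => rfl
  have hvi : IntervalIntegrable v volume 0 t :=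
    (intervalIntegrable_iff_integrableOn_Ioo_of_le hm.1.le).2
      (hv.mono_set (Ioo_subset_Ioo_right hm.2.le))
  have h4 : causalConv (fun s => c⁻¹ * (1 - k s)) v t = c⁻¹ * (u t - causalConv k v t) := by
    rw [huv t hm, causalConv, causalConv, ← intervalIntegral.integral_sub hvi
      (hvi.continuousOn_mul (by fun_prop)), ← intervalIntegral.integral_const_mul]
    congr 1; ext s; ring
  rw [h2, h3, h4, causalConv_const_mul_right, hkv t hm] at h1
  field_simp at h1
  linarith

theorem memH1_of_eq_zero {b : ℝ} {u : ℝ → ℝ} (h : ∀ t ∈ Ioo 0 b, u t = 0) :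
    HasWeakDeriv 0 b u 0 ∧ MemH1 0 b u := by
  have hae : u =ᵐ[volume.restrict (Ioo 0 b)] 0 :=
    (ae_restrict_iff' measurableSet_Ioo).2 (Filter.Eventually.of_forall h)
  have hw : HasWeakDeriv 0 b u 0 := by
    refine ⟨?_, ?_, fun φ _ _ _ => ?_⟩
    · exact IntegrableOn.locallyIntegrableOn ((integrable_zero _ _ _).congr hae.symm)
    · exact IntegrableOn.locallyIntegrableOn (integrable_zero _ _ _)
    · rw [setIntegral_congr_fun measurableSet_Ioo
        (g := fun _ => (0 : ℝ)) fun x hx => by simp [h x hx]]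
      simp
  exact ⟨hw, MemLp.zero.ae_eq hae.symm, 0, MemLp.zero, hw⟩

theorem corollary3p5 (B : ℝ → ℝ) (hBpos : ∀ a ∈ Icc (0 : ℝ) 1, 0 < B a)
    (hB0 : B 0 = 1) (hB1 : B 1 = 1)
    (α : ℝ) (hα0 : 0 < α) (hα1 : α < 1) (b : ℝ) (hb : 0 < b)
    (lam : ℝ) (hlam : lam ≠ 0) (u : ℝ → ℝ) :
    (MemH1 0 b u ∧ ContinuousOn u (Icc 0 b) ∧
        ∀ t ∈ Ioo 0 b, abcDeriv B α 0 b u t = lam * u t) ↔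
      ∀ t ∈ Icc 0 b, u t = 0 := by
  constructor
  · rintro ⟨⟨-, v, hv2, hw⟩, hu, heq⟩
    have hv : IntegrableOn v (Ioo 0 b) := hv2.integrable (by norm_num)
    have h1α : 0 < 1 - α := by linarith
    set c := α / (1 - α) with hc
    have hc0 : c ≠ 0 := (div_pos hα0 h1α).ne'
    set K := B α / (1 - α) with hK
    have hK0 : K ≠ 0 := (div_pos (hBpos α ⟨hα0.le, hα1.le⟩) h1α).ne'
    have h : ∀ t ∈ Ioo 0 b,
        K * causalConv (fun s => mittagLeffler α (-c * s ^ α)) v t = lam * u t := by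
      intro t ht
      rw [← heq t ht, abcDeriv_eq hw ht.1.le ht.2.le]
      rfl
    have hu0 : u 0 = 0 := by
      have h1 := (tendsto_causalConv_nhdsGT_zero hb
        (continuous_mittagLeffler_rpow hα0 c) hv).const_mul K
      have h2 : Filter.Tendsto (fun t => lam * u t) (nhdsWithin 0 (Ioo 0 b)) (nhds (lam * u 0)) :=
        ((hu 0 (left_mem_Icc.2 hb.le)).tendsto.mono_left
          (nhdsWithin_mono 0 Ioo_subset_Icc_self)).const_mul lam
      have := left_nhdsWithin_Ioo_neBot hb
      have h3 := tendsto_nhds_unique_of_eventuallyEq h2 h1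
        (Filter.eventuallyEq_of_mem self_mem_nhdsWithin fun t ht => (h t ht).symm)
      rw [mul_zero] at h3
      exact (mul_eq_zero.1 h3).resolve_left hlam
    have huv : ∀ t ∈ Ioo 0 b, u t = ∫ s in (0 : ℝ)..t, v s := fun t ht => by
      rw [hw.eq_add_integral hb hu hv t (Ioo_subset_Icc_self ht), hu0, zero_add]
    have habel := abel_equation_of_causalConv_mittagLeffler hα0 hb hc0 hK0 hv huv h
    -- At K = λ the Abel equation degenerates to first kind; otherwise it is of second kind.
    rcases eq_or_ne K lam with hKl | hKl
    · refine eq_zero_of_ae_causalConv_fracKernel_eq_zero hα0 hα1 hb hu ?_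
      filter_upwards [habel] with t ht hm
      have := ht hm
      rw [hKl, sub_self, zero_mul] at this
      exact (mul_eq_zero.1 this.symm).resolve_left (mul_ne_zero hc0 hlam)
    · refine eq_zero_of_ae_eq_mul_causalConv_fracKernel (μ := c * lam / (K - lam)) hα0 hb hu ?_
      filter_upwards [habel] with t ht hm
      have := ht hm
      have hd := sub_ne_zero.2 hKl
      field_simp
      linarith
  · intro h
    obtain ⟨hw, hm⟩ := memH1_of_eq_zero fun t ht => h t (Ioo_subset_Icc_self ht)
    refine ⟨hm, continuousOn_const.congr h, fun t ht => ?_⟩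
    rw [abcDeriv_eq hw ht.1.le ht.2.le, h t (Ioo_subset_Icc_self ht)]
    simp
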